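/- For an abelian group $G$ let $\mathbb{N}[G]$ denote its group semiring. A \emph{tract} is a commutative monoid $F$ with an absorbing element $0$ such that $F^\times=F\setminus\{0\}$ is a group, together with a subset $N_F\subseteq\mathbb{N}[F^\times]$ that contains $0$, is closed under multiplication by elements of $F^\times$, and is such that there is a unique $\epsilon\in F^\times$ with $1+\epsilon\in N_F$. An \emph{involution} of $F$ is a map $\tau:F\to F$ with $\tau(0)=0$ that restricts to a group homomorphism on $F^\times$, maps $N_F$ into $N_F$, and satisfies $\tau^2=\mathrm{id}$. For a finite set $E$ and $X,Y\in F^E$, write $X\perp Y$ if $\sum_{e\in E}X(e)\,\tau(Y(e))\in N_F$, where the sum is the formal one in $\mathbb{N}[F^\times]$ and zero terms are omitted. An \emph{$F$-signature} of a matroid $\underline M$ on $E$ is a subset $C\subseteq F^E$ with $0\notin C$, closed under multiplication by $F^\times$, such that taking supports gives a bijection from the set of $F^\times$-orbits of $C$ to the set of circuits of $\underline M$. An \emph{$F$-matroid} $M$ on $E$ (with respect to $\tau$) is a matroid $\underline M$ on $E$ together with an $F$-signature $C(M)$ of $\underline M$ and an $F$-signature $C^*(M)$ of the dual matroid $\underline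 M^*$ such that $X\perp Y$ for all $X\in C(M)$ and $Y\in C^*(M)$. A \emph{vector} (resp. \emph{covector}) of $M$ is an $X\in F^E$ with $X\perp Y$ for all $Y\in C^*(M)$ (resp. for all $Y\in C(M)$). The tract $F$ is \emph{perfect} if, for every involution of $F$, every finite set $E$ and every $F$-matroid $M$ on $E$, one has $X\perp Y$ for every vector $X$ and every covector $Y$ of $M$. A \emph{simplified fuzzy ring} is a tuple $(K,+,\cdot,\epsilon,K_0)$ where $(K,+,\cdot)$ is a commutative semiring equal to the group semiring $\mathbb{N}[K^\times]$ of its group of units (that is, the canonical map $\mathbb{N}[K^\times]\to K$ is bijective), $\epsilon\in K^\times$, and $K_0\subseteq K$, such that: \begin{itemize} \item[(FR4)] $K_0+K_0\subseteq K_0$, $K\cdot K_0\subseteq K_0$, $0\in K_0$ and $1\notin K_0$; \item[(FR5)] for $\alpha\in K^\times$ one has $1+\alpha\in K_0$ if and only if $\alpha=\epsilon$; \item[(FR6)] if $x_1,x_2,y_1,y_2\in K$ and $x_1+y_1,\ x_2+y_2\in K_0$, then $x_1x_2+\epsilon y_1y_2\in K_0$. \end{itemize} Its associated tract is $F_K=K^\times\cup\{0\}$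 with null set $N_{F_K}=K_0\subseteq K=\mathbb{N}[K^\times]$. \textbf{Theorem.} Let $K$ be a simplified fuzzy ring which satisfies \begin{itemize} \item[(FR6$''$)] if $\kappa,\lambda_1,\lambda_2\in K$, $\mu\in K\setminus K_0$, and $\kappa+\mu\lambda_1,\ \mu+\lambda_2\in K_0$, then $\kappa+\epsilon\lambda_1\lambda_2\in K_0$. \end{itemize} Then $K$ is perfect, i.e. its associated tract $F_K$ is perfect. -/

import Mathlib

universe u v

/-- A tract with underlying commutative monoid with zero `F`, whose nonzero elements form the group
`Fˣ`; the null set is a subset of the group semiring `ℕ[Fˣ]`. -/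
structure Tract (F : Type u) [CommGroupWithZero F] where
  nullSet : Set (MonoidAlgebra ℕ Fˣ)
  zero_mem : 0 ∈ nullSet
  existsUnique_neg : ∃! ε : Fˣ, 1 + MonoidAlgebra.of ℕ Fˣ ε ∈ nullSet
  smul_mem : ∀ (g : Fˣ) (a : MonoidAlgebra ℕ Fˣ), a ∈ nullSet →
    MonoidAlgebra.of ℕ Fˣ g * a ∈ nullSet

namespace Tract

open Classical in
/-- The inclusion of `F` into `ℕ[Fˣ]`: zero goes to the empty sum, a nonzero element to the
corresponding one-term sum. -/
noncomputable def incl {F : Type u} [CommGroupWithZero F] (x : F) : MonoidAlgebra ℕ Fˣ :=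
  if h : x = 0 then 0 else MonoidAlgebra.of ℕ Fˣ (Units.mk0 x h)

variable {F : Type u} [CommGroupWithZero F]

/-- An involution of a tract: a tract endomorphism whose square is the identity. -/
structure Involution (T : Tract F) where
  toHom : F →*₀ F
  map_null : ∀ a ∈ T.nullSet,
    MonoidAlgebra.mapDomain (Units.map (toHom : F →* F)) a ∈ T.nullSet
  involutive : ∀ x : F, toHom (toHom x) = x

variable {E : Type v} [Fintype E]

/-- The inner product `∑ₑ X(e) · τ(Y(e))`, a formal sum of elements of `F`. -/
noncomputable def inner {T : Tract F} (τ : T.Involution) (X Y : E → F) : MonoidAlgebra ℕ Fˣ :=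
  ∑ e, incl (X e * τ.toHom (Y e))

/-- Orthogonality of elements of `F^E`. -/
def Orthogonal {T : Tract F} (τ : T.Involution) (X Y : E → F) : Prop :=
  inner τ X Y ∈ T.nullSet

/-- `C ⊆ F^E` is an `F`-signature of the matroid `M`. The last three fields say that supports
induce a bijection from the set of `Fˣ`-orbits of `C` to the set of circuits of `M`: the map is well
defined, surjective and injective. -/
structure IsSignature (M : Matroid E) (C : Set (E → F)) : Prop where
  zero_notMem : (0 : E → F) ∉ C
  smul_mem : ∀ X ∈ C, ∀ a : Fˣ, (fun e => (a : F) * X e) ∈ C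
  support_isCircuit : ∀ X ∈ C, M.IsCircuit (Function.support X)
  exists_support_eq : ∀ S, M.IsCircuit S → ∃ X ∈ C, Function.support X = S
  eq_smul_of_support_eq : ∀ X ∈ C, ∀ Y ∈ C, Function.support X = Function.support Y →
    ∃ a : Fˣ, Y = fun e => (a : F) * X e

/-- A (strong) matroid over the tract `T` with involution `τ`, on the finite ground set `E`: a
matroid on `E` together with a dual pair of signatures. -/
structure FMatroid {T : Tract F} (τ : T.Involution) (E : Type v) [Fintype E] where
  underlying : Matroid E
  ground_eq : underlying.E = Set.univ
  circuits : Set (E → F)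
  cocircuits : Set (E → F)
  isSignature_circuits : IsSignature underlying circuits
  isSignature_cocircuits : IsSignature underlying.dual cocircuits
  orthogonal : ∀ X ∈ circuits, ∀ Y ∈ cocircuits, Orthogonal τ X Y

namespace FMatroid

variable {T : Tract F} {τ : T.Involution}

/-- The set `V(M)` of vectors of `M`. -/
def vectors (M : FMatroid τ E) : Set (E → F) :=
  {X | ∀ Y ∈ M.cocircuits, Orthogonal τ X Y}

/-- The set `V*(M)` of covectors of `M`. -/
def covectors (M : FMatroid τ E) : Set (E → F) :=
  {X | ∀ Y ∈ M.circuits, Orthogonal τ X Y}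

end FMatroid

/-- A tract is perfect if vectors and covectors are orthogonal for every matroid over it, on any
finite ground set and with respect to any involution. -/
def IsPerfect (T : Tract F) : Prop :=
  ∀ (τ : T.Involution) (E : Type v) [Fintype E] (M : FMatroid τ E),
    ∀ X ∈ M.vectors, ∀ Y ∈ M.covectors, Orthogonal τ X Y

end Tract

/-- A simplified fuzzy ring `(K, +, ·, ε, K₀)`. The first field says that the commutative semiring
`K` is the group semiring `ℕ[Kˣ]` of its own unit group; `K₀` is a proper semiring ideal. -/
structure SimplifiedFuzzyRing (K : Type u) [CommSemiring K] where
  bijective_lift : Function.Bijective (MonoidAlgebra.lift ℕ K Kˣ (Units.coeHom K))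
  ε : Kˣ
  K₀ : Ideal K
  one_notMem : (1 : K) ∉ K₀
  one_add_mem_iff : ∀ α : Kˣ, 1 + (α : K) ∈ K₀ ↔ α = ε
  fr6 : ∀ x₁ x₂ y₁ y₂ : K, x₁ + y₁ ∈ K₀ → x₂ + y₂ ∈ K₀ → x₁ * x₂ + ε * y₁ * y₂ ∈ K₀

namespace SimplifiedFuzzyRing

variable {K : Type u} [CommSemiring K]

/-- The axiom (FR6''). -/
def FR6'' (R : SimplifiedFuzzyRing K) : Prop :=
  ∀ κ lam₁ lam₂ μ : K, μ ∉ R.K₀ → κ + μ * lam₁ ∈ R.K₀ → μ + lam₂ ∈ R.K₀ →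
    κ + R.ε * lam₁ * lam₂ ∈ R.K₀

/-- The canonical identification of `ℕ[Fˣ]` with `K`, for `F = Kˣ ∪ {0}`. -/
noncomputable def eval (K : Type u) [CommSemiring K] :
    MonoidAlgebra ℕ (WithZero Kˣ)ˣ →ₐ[ℕ] K :=
  MonoidAlgebra.lift ℕ K (WithZero Kˣ)ˣ
    ((Units.coeHom K).comp (WithZero.unitsWithZeroEquiv (α := Kˣ)).toMonoidHom)

theorem eval_of (g : (WithZero Kˣ)ˣ) :
    eval K (MonoidAlgebra.of ℕ _ g) = (WithZero.unitsWithZeroEquiv g : Kˣ) := by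
  simp [eval]

/-- The tract associated with a simplified fuzzy ring: its underlying monoid with zero is
`Kˣ ∪ {0}`, and its null set is `K₀`, seen inside `ℕ[Kˣ] = K`. -/
noncomputable def toTract (R : SimplifiedFuzzyRing K) : Tract (WithZero Kˣ) where
  nullSet := {a | eval K a ∈ R.K₀}
  zero_mem := by simp
  existsUnique_neg := by
    refine ⟨WithZero.unitsWithZeroEquiv.symm R.ε, ?_, fun g hg => ?_⟩
    · simp only [Set.mem_ofPred_eq, map_add, map_one, eval_of, MulEquiv.apply_symm_apply]
      exact (R.one_add_mem_iff _).2 rfl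
    · simp only [Set.mem_ofPred_eq, map_add, map_one, eval_of] at hg
      rw [MulEquiv.eq_symm_apply]
      exact (R.one_add_mem_iff _).1 hg
  smul_mem := fun g a ha => by
    simp only [Set.mem_ofPred_eq, map_mul]
    exact R.K₀.mul_mem_left _ ha

end SimplifiedFuzzyRing

/-! ### Arithmetic of `ε`. -/

namespace SimplifiedFuzzyRing

variable {K : Type u} [CommSemiring K] (R : SimplifiedFuzzyRing K)

/-! (FR6'') acts as a substitution rule: inside a null sum, a non-null `μ` may be replaced by `εν`
once `μ + ν` is null (`FR6''.subst_ε`). `FR6''.sum_mul_mem` uses it in an induction over minors,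
shrinking the support `S` of a vector `X`. Covector entries become sums on the way, so everything is
stated with entries in `K`.

If some cocircuit `d` of the minor pairs to a non-null sum with `X` on `S \ {e}`, contract `e`:
subtracting a multiple of `d` clears `Y` at `e`, and substitution restores the term `X e * Y e`.
Otherwise `X` remains a vector on each `S \ {e}`, so those partial sums are null by induction.
Comparing null and non-null partial sums then yields the full sum, down to a single element, settled
by whether it is a loop. -/

theorem one_add_ε_mem : 1 + (R.ε : K) ∈ R.K₀ := (R.one_add_mem_iff _).2 rfl

theorem unit_notMem (a : Kˣ) : (a : K) ∉ R.K₀ := fun h =>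
  R.one_notMem (by simpa using R.K₀.mul_mem_left ((a⁻¹ : Kˣ) : K) h)

/-- Scaling `1 + ε` by `ε⁻¹` gives the null sum `1 + ε⁻¹`, so uniqueness forces `ε⁻¹ = ε`. -/
theorem ε_mul_ε : (R.ε : K) * R.ε = 1 := by
  have h : 1 + ((R.ε⁻¹ : Kˣ) : K) ∈ R.K₀ := by
    have := R.K₀.mul_mem_left ((R.ε⁻¹ : Kˣ) : K) R.one_add_ε_mem
    rwa [mul_add, Units.inv_mul, mul_one, add_comm] at this
  have h' := (R.one_add_mem_iff _).1 h
  nth_rewrite 1 [← h']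
  simp

theorem ε_mul_mem_iff {x : K} : R.ε * x ∈ R.K₀ ↔ x ∈ R.K₀ := by
  refine ⟨fun h => ?_, fun h => R.K₀.mul_mem_left _ h⟩
  have := R.K₀.mul_mem_left R.ε h
  rwa [← mul_assoc, R.ε_mul_ε, one_mul] at this

/-! ### Substitution in null sums. -/

variable {R}

/-- Under (FR6''), an element `μ ∉ K₀` may be replaced by any `ν` with `μ + εν ∈ K₀`. -/
theorem FR6''.subst (hR : R.FR6'') {μ ν : K} (hμ : μ ∉ R.K₀) (h : μ + R.ε * ν ∈ R.K₀)
    {κ lam : K} (hκ : κ + μ * lam ∈ R.K₀) : κ + ν * lam ∈ R.K₀ := by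
  have := hR κ lam (R.ε * ν) μ hμ hκ h
  have e : κ + R.ε * lam * (R.ε * ν) = κ + (R.ε * R.ε : K) * (ν * lam) := by ring
  rwa [e, R.ε_mul_ε, one_mul] at this

/-- If `μ ∉ K₀` and `μ + ν ∈ K₀`, then `μ` may be replaced by `εν`. -/
theorem FR6''.subst_ε (hR : R.FR6'') {μ ν : K} (hμ : μ ∉ R.K₀) (h : μ + ν ∈ R.K₀)
    {κ lam : K} (hκ : κ + μ * lam ∈ R.K₀) : κ + R.ε * ν * lam ∈ R.K₀ := by
  refine hR.subst hμ ?_ hκ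
  rwa [← mul_assoc, R.ε_mul_ε, one_mul]

/-- If `ρ ∉ K₀` becomes null on adding `p`, `q` or `p + q`, then `p` may be doubled. -/
theorem FR6''.two_mul_add_ε_mem (hR : R.FR6'') {ρ p q : K} (hρ : ρ ∉ R.K₀) (hq : q ∉ R.K₀)
    (h₁ : ρ + p ∈ R.K₀) (h₂ : ρ + q ∈ R.K₀) (h₁₂ : ρ + (p + q) ∈ R.K₀) :
    p + R.ε * (p + p) ∈ R.K₀ := by
  have a : p + q + R.ε * p ∈ R.K₀ := by
    simpa using hR.subst_ε hρ h₁ (κ := p + q) (lam := 1) (by rwa [mul_one, add_comm])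
  have b : q + R.ε * p ∈ R.K₀ := by
    simpa using hR.subst_ε hρ h₁ (κ := q) (lam := 1) (by rwa [mul_one, add_comm])
  have c : (p + R.ε * p) + p * 1 ∈ R.K₀ :=
    hR.subst hq b (by rw [mul_one]; convert a using 1; ring)
  rw [← R.ε_mul_mem_iff]
  have e : R.ε * (p + R.ε * (p + p)) = R.ε * p + (R.ε * R.ε : K) * (p + p) := by ring
  rw [e, R.ε_mul_ε, one_mul]
  convert c using 1; ring

/-- If `κ ∉ K₀` and both `κ + xw` and `κ + (xw + xu)` are null, then `xu` may be added to any null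
sum containing `xw`. -/
theorem FR6''.add_mem_of_three (hR : R.FR6'') {κ xw xu s : K} (hκ : κ ∉ R.K₀) (hw : xw ∉ R.K₀)
    (h₁ : κ + xw ∈ R.K₀) (h₂ : κ + (xw + xu) ∈ R.K₀) (h₃ : s + xw ∈ R.K₀) :
    s + xw + xu ∈ R.K₀ := by
  have a : xw + xu + R.ε * xw ∈ R.K₀ := by
    simpa using hR.subst_ε hκ h₁ (κ := xw + xu) (lam := 1) (by rwa [mul_one, add_comm])
  have b : s + (xw + xu) * 1 ∈ R.K₀ := by
    refine hR.subst hw ?_ (by rwa [mul_one])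
    rw [← R.ε_mul_mem_iff]
    have e : R.ε * (xw + R.ε * (xw + xu)) = R.ε * xw + (R.ε * R.ε : K) * (xw + xu) := by ring
    rw [e, R.ε_mul_ε, one_mul, add_comm]
    exact a
  rwa [mul_one, ← add_assoc] at b

/-- If `κ ∉ K₀`, if `κ + x` and `κ + y` are null and `x` may be doubled, then `κ + x + y` is
null. -/
theorem FR6''.add_add_mem_of_two (hR : R.FR6'') {κ p l y : K} (hκ : κ ∉ R.K₀)
    (hx : p * l ∉ R.K₀) (hp : p + R.ε * (p + p) ∈ R.K₀)
    (h₁ : κ + p * l ∈ R.K₀) (h₂ : κ + y ∈ R.K₀) : κ + p * l + y ∈ R.K₀ := by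
  have hp' : p ∉ R.K₀ := fun h => hx (R.K₀.mul_mem_right _ h)
  -- Of the two copies of `p * l`, one stays and the other is exchanged for `y`.
  have a : κ + (p + p) * l ∈ R.K₀ := hR.subst hp' hp h₁
  have b : p * l + R.ε * y ∈ R.K₀ := by
    simpa using hR.subst_ε hκ h₂ (κ := p * l) (lam := 1) (by rwa [mul_one, add_comm])
  simpa using hR.subst hx b (κ := κ + p * l) (lam := 1) (by convert a using 1; ring)

/-! ### Induction over minors. -/

/-- Orthogonality of vectors and covectors of a minor, with entries in `K`: the set `A` is
contracted, and everything outside `S` and `A` is deleted. -/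
theorem FR6''.sum_mul_mem {E : Type v} [Fintype E] [DecidableEq E] (hR : R.FR6'') {C D : Set (E → K)}
    (hC : ∀ c ∈ C, ∀ e, c e = 0 ∨ IsUnit (c e)) (hD : ∀ d ∈ D, ∀ e, d e = 0 ∨ IsUnit (d e))
    (hCD : ∀ c ∈ C, ∀ d ∈ D, ∑ e, c e * d e ∈ R.K₀)
    (hloop : ∀ (A : Finset E) (e : E), e ∉ A →
      (∃ d ∈ D, (∀ a ∈ A, d a = 0) ∧ d e ≠ 0) ∨
        ∃ c ∈ C, c e ≠ 0 ∧ ∀ f, f ∉ A → f ≠ e → c f = 0)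
    (X : E → K) (S A : Finset E) (hSA : Disjoint S A) (Y : E → K)
    (hX : ∀ d ∈ D, (∀ a ∈ A, d a = 0) → ∑ f ∈ S, X f * d f ∈ R.K₀)
    (hY : ∀ c ∈ C, ∑ f ∈ Aᶜ, Y f * c f ∈ R.K₀) :
    ∑ f ∈ S, X f * Y f ∈ R.K₀ := by
  induction S using Finset.strongInduction generalizing A Y with
  | H S ih =>
  classical
  by_cases good : ∃ e ∈ S, ∃ d ∈ D, (∀ a ∈ A, d a = 0) ∧ ∑ f ∈ S.erase e, X f * d f ∉ R.K₀
  · obtain ⟨e, he, d, hd, hdA, hlam⟩ := good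
    have heA : e ∉ A := fun h => (Finset.disjoint_left.1 hSA) he h
    obtain h0 | ⟨u, hu⟩ := hD d hd e
    · refine absurd ?_ hlam
      have := hX d hd hdA
      rwa [← Finset.add_sum_erase _ _ he, h0, mul_zero, zero_add] at this
    -- Scaling by `v` normalises `d` to have entry `1` at `e`.
    set v : K := ((u⁻¹ : Kˣ) : K) with hv
    have huv : d e * v = 1 := by rw [← hu]; simp [hv]
    have hvd : ∀ x y : K, x * (y * v) = v * (x * y) := fun x y => by ring
    set lam := ∑ f ∈ S.erase e, X f * (d f * v) with hlamdef
    have hlam' : lam ∉ R.K₀ := by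
      intro h
      apply hlam
      have h2 := R.K₀.mul_mem_left (d e) h
      simp only [hlamdef, hvd, ← Finset.mul_sum] at h2
      rwa [← mul_assoc, huv, one_mul] at h2
    have hXe : lam + X e ∈ R.K₀ := by
      have h2 := R.K₀.mul_mem_left v (hX d hd hdA)
      rw [Finset.mul_sum] at h2
      simp only [← hvd] at h2
      rwa [← Finset.sum_erase_add _ _ he, huv, mul_one] at h2
    have key := ih (S.erase e) (Finset.erase_ssubset he) (insert e A) (by
        rw [Finset.disjoint_insert_right]
        exact ⟨by simp, hSA.mono_left (Finset.erase_subset _ _)⟩)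
      (fun f => Y f + R.ε * Y e * (d f * v)) (by
        intro d' hd' hdA'
        have h2 := hX d' hd' fun a ha => hdA' a (Finset.mem_insert_of_mem ha)
        rwa [← Finset.add_sum_erase _ _ he, hdA' e (Finset.mem_insert_self _ _), mul_zero,
          zero_add] at h2) (by
        intro c hc
        have h2 := hY c hc
        have hmem : e ∈ Aᶜ := by simpa using heA
        have h3 : c e + ∑ f ∈ Aᶜ.erase e, c f * (d f * v) ∈ R.K₀ := by
          have h4 := R.K₀.mul_mem_left v (hCD c hc d hd)
          rw [Finset.mul_sum] at h4
          simp only [← hvd] at h4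
          rw [← Finset.sum_compl_add_sum A, Finset.sum_eq_zero (s := A) fun a ha => by
            rw [hdA a ha]; simp, add_zero, ← Finset.add_sum_erase _ _ hmem, huv, mul_one] at h4
          exact h4
        rw [Finset.compl_insert]
        have e1 : ∑ f ∈ Aᶜ.erase e, (Y f + R.ε * Y e * (d f * v)) * c f =
            ∑ f ∈ Aᶜ.erase e, Y f * c f +
              R.ε * (∑ f ∈ Aᶜ.erase e, c f * (d f * v)) * Y e := by
          rw [Finset.mul_sum, Finset.sum_mul, ← Finset.sum_add_distrib]
          exact Finset.sum_congr rfl fun f _ => by ring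
        rw [e1]
        rw [← Finset.sum_erase_add _ _ hmem] at h2
        obtain h0 | ⟨w, hw⟩ := hC c hc e
        · rw [h0, mul_zero, add_zero] at h2
          rw [h0, zero_add] at h3
          exact R.K₀.add_mem h2 (R.K₀.mul_mem_right _ (R.K₀.mul_mem_left _ h3))
        -- A unit is never null, so `c e` can be traded for its complement in `c ⊥ d`.
        · exact hR.subst_ε (hw ▸ R.unit_notMem w) h3 (by rwa [mul_comm (c e)]))
    have e2 : ∑ f ∈ S.erase e, X f * (Y f + R.ε * Y e * (d f * v)) =
        ∑ f ∈ S.erase e, X f * Y f + lam * (R.ε * Y e) := by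
      rw [hlamdef, Finset.sum_mul, ← Finset.sum_add_distrib]
      exact Finset.sum_congr rfl fun f _ => by ring
    rw [e2] at key
    have h5 := hR.subst_ε hlam' hXe key
    have e3 : (R.ε : K) * X e * (R.ε * Y e) = (R.ε * R.ε : K) * (X e * Y e) := by ring
    rw [e3, R.ε_mul_ε, one_mul, Finset.sum_erase_add _ _ he] at h5
    exact h5
  push Not at good
  have hsub : ∀ T, T ⊂ S → (∀ d ∈ D, (∀ a ∈ A, d a = 0) → ∑ f ∈ T, X f * d f ∈ R.K₀) →
      ∑ f ∈ T, X f * Y f ∈ R.K₀ := fun T hT h =>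
    ih T hT A (hSA.mono_left hT.subset) Y h hY
  have herase : ∀ e ∈ S, ∑ f ∈ S.erase e, X f * Y f ∈ R.K₀ := fun e he =>
    hsub _ (Finset.erase_ssubset he) (good e he)
  by_cases hunit : ∃ e ∈ S, X e * Y e ∈ R.K₀
  · obtain ⟨e, he, hxe⟩ := hunit
    rw [← Finset.add_sum_erase _ _ he]
    exact R.K₀.add_mem hxe (herase e he)
  push Not at hunit
  by_cases hT : ∃ T, T ⊂ S ∧ ∑ f ∈ T, X f * Y f ∉ R.K₀
  -- Maximality makes the sum over `T` non-null, yet null after adding further elements short of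
  -- `S`. `T` misses at least two elements, since each `S.erase e` gives a null sum.
  · obtain ⟨T, hT, hTmax⟩ := Finset.exists_maximal (s := S.ssubsets.filter
      fun T => ∑ f ∈ T, X f * Y f ∉ R.K₀) (by
        obtain ⟨T, h1, h2⟩ := hT
        exact ⟨T, by simp [h1, h2]⟩)
    simp only [Finset.mem_filter, Finset.mem_ssubsets] at hT hTmax
    obtain ⟨hTS, hTn⟩ := hT
    have hbig : ∀ U, T ⊂ U → U ⊂ S → ∑ f ∈ U, X f * Y f ∈ R.K₀ := by
      intro U h1 h2
      by_contra h3
      exact h1.not_subset (hTmax ⟨h2, h3⟩ h1.subset)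
    obtain ⟨w, hwS, hwT⟩ := Finset.exists_of_ssubset hTS
    have hwT' : insert w T ⊂ S := by
      refine Finset.ssubset_iff_subset_ne.2 ⟨Finset.insert_subset hwS hTS.subset, ?_⟩
      intro h
      apply hTn
      have := herase w hwS
      rwa [← h, Finset.erase_insert hwT] at this
    obtain ⟨z, hzS, hzT⟩ := Finset.exists_of_ssubset hwT'
    have hzw : z ≠ w := fun h => hzT (h ▸ Finset.mem_insert_self _ _)
    have hzT' : z ∉ T := fun h => hzT (Finset.mem_insert_of_mem h)
    have h₁ : ∑ f ∈ T, X f * Y f + X w * Y w ∈ R.K₀ := by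
      have := hbig _ (Finset.ssubset_insert hwT) hwT'
      rwa [Finset.sum_insert hwT, add_comm] at this
    by_cases h3 : insert z (insert w T) = S
    · have hSz : S.erase z = insert w T := by rw [← h3, Finset.erase_insert hzT]
      have hSw : S.erase w = insert z T := by
        rw [← h3, Finset.insert_comm, Finset.erase_insert]
        simp [hwT, hzw.symm]
      have h₂ : ∑ f ∈ T, X f * Y f + X z * Y z ∈ R.K₀ := by
        have := herase w hwS
        rwa [hSw, Finset.sum_insert hzT', add_comm] at this
      -- `X` cannot be a vector on `T`, or induction would make the sum over `T` null. The witness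
      -- `d` lets `X w` be doubled.
      have : ∃ d ∈ D, (∀ a ∈ A, d a = 0) ∧ ∑ f ∈ T, X f * d f ∉ R.K₀ := by
        by_contra! h
        exact hTn (hsub T hTS h)
      obtain ⟨d, hd, hdA, hρ⟩ := this
      have k1 : ∑ f ∈ T, X f * d f + X w * d w ∈ R.K₀ := by
        have := good z hzS d hd hdA
        rwa [hSz, Finset.sum_insert hwT, add_comm] at this
      have k2 : ∑ f ∈ T, X f * d f + X z * d z ∈ R.K₀ := by
        have := good w hwS d hd hdA
        rwa [hSw, Finset.sum_insert hzT', add_comm] at this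
      have k3 : ∑ f ∈ T, X f * d f + (X w * d w + X z * d z) ∈ R.K₀ := by
        have := hX d hd hdA
        rw [← h3, Finset.sum_insert hzT, Finset.sum_insert hwT] at this
        convert this using 1; ring
      have hdz : X z * d z ∉ R.K₀ := by
        intro h
        obtain h0 | ⟨u, hu⟩ := hD d hd z
        · rw [h0, mul_zero, add_zero] at k2
          exact hρ k2
        · refine hunit z hzS (R.K₀.mul_mem_right _ ?_)
          have := R.K₀.mul_mem_right ((u⁻¹ : Kˣ) : K) h
          rwa [← hu, mul_assoc, Units.mul_inv, mul_one] at this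
      have hdouble := hR.two_mul_add_ε_mem hρ hdz k1 k2 k3
      obtain h0 | ⟨u, hu⟩ := hD d hd w
      · rw [h0, mul_zero, add_zero] at k1
        exact absurd k1 hρ
      have hdouble' : X w + R.ε * (X w + X w) ∈ R.K₀ := by
        have := R.K₀.mul_mem_right ((u⁻¹ : Kˣ) : K) hdouble
        have e : (X w * d w + R.ε * (X w * d w + X w * d w)) * ((u⁻¹ : Kˣ) : K) =
          (X w + R.ε * (X w + X w)) * (d w * ((u⁻¹ : Kˣ) : K)) := by ring
        rwa [e, ← hu, Units.mul_inv, mul_one] at this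
      have := hR.add_add_mem_of_two hTn (hunit w hwS) hdouble' h₁ h₂
      rw [← h3, Finset.sum_insert hzT, Finset.sum_insert hwT]
      convert this using 1; ring
    · have h4 : insert z (insert w T) ⊂ S := Finset.ssubset_iff_subset_ne.2
        ⟨Finset.insert_subset hzS hwT'.subset, h3⟩
      have h₂ : ∑ f ∈ T, X f * Y f + (X w * Y w + X z * Y z) ∈ R.K₀ := by
        have := hbig _ ((Finset.ssubset_insert hwT).trans (Finset.ssubset_insert hzT)) h4
        rw [Finset.sum_insert hzT, Finset.sum_insert hwT] at this
        convert this using 1; ring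
      have hwz : w ∈ S.erase z := Finset.mem_erase.2 ⟨hzw.symm, hwS⟩
      have := hR.add_mem_of_three hTn (hunit w hwS) h₁ h₂
        (s := ∑ f ∈ (S.erase z).erase w, X f * Y f) (by
          rw [Finset.sum_erase_add _ _ hwz]; exact herase z hzS)
      rwa [Finset.sum_erase_add _ _ hwz, Finset.sum_erase_add _ _ hzS] at this
  push Not at hT
  obtain rfl | ⟨e, he⟩ := S.eq_empty_or_nonempty
  · simp
  by_cases hs : {e} ⊂ S
  -- All proper partial sums are null but no single term is, so `S` has one element.
  · exact absurd (by simpa using hT {e} hs) (hunit e he)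
  have hSe : S = {e} := by
    by_contra h
    exact hs (Finset.ssubset_iff_subset_ne.2 ⟨by simpa using he, Ne.symm h⟩)
  subst hSe
  have heA : e ∉ A := by simpa using hSA
  exfalso
  apply hunit e he
  -- A non-loop of the contraction forces `X e` null; a loop forces `Y e` null.
  obtain ⟨d, hd, hdA, hde⟩ | ⟨c, hc, hce, hcA⟩ := hloop A e heA
  · obtain h0 | ⟨u, hu⟩ := hD d hd e
    · exact absurd h0 hde
    refine R.K₀.mul_mem_right _ ?_
    have := R.K₀.mul_mem_right ((u⁻¹ : Kˣ) : K) (hX d hd hdA)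
    rwa [Finset.sum_singleton, ← hu, mul_assoc, Units.mul_inv, mul_one] at this
  · obtain h0 | ⟨u, hu⟩ := hC c hc e
    · exact absurd h0 hce
    refine R.K₀.mul_mem_left _ ?_
    have h2 := hY c hc
    rw [Finset.sum_eq_single e (fun f hf hfe => by
      rw [hcA f (by simpa using hf) hfe, mul_zero]) (fun h => absurd (by simpa using heA) h)] at h2
    have := R.K₀.mul_mem_right ((u⁻¹ : Kˣ) : K) h2
    rwa [← hu, mul_assoc, Units.mul_inv, mul_one] at this

/-! ### From the tract to `K`. -/

/-- The inclusion of `Kˣ ∪ {0}` into `K`. -/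
noncomputable def val (x : WithZero Kˣ) : K := eval K (Tract.incl x)

theorem val_zero : val (0 : WithZero Kˣ) = 0 := by simp [val, Tract.incl]

theorem val_of_ne_zero {x : WithZero Kˣ} (hx : x ≠ 0) :
    val x = (WithZero.unitsWithZeroEquiv (Units.mk0 x hx) : Kˣ) := by
  simp only [val, Tract.incl, hx, dite_false, eval_of]

theorem isUnit_val {x : WithZero Kˣ} (hx : x ≠ 0) : IsUnit (val x) :=
  ⟨_, (val_of_ne_zero hx).symm⟩

theorem val_mul (x y : WithZero Kˣ) : val (x * y) = val x * val y := by
  by_cases hx : x = 0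
  · simp [hx, val_zero]
  by_cases hy : y = 0
  · simp [hy, val_zero]
  rw [val_of_ne_zero hx, val_of_ne_zero hy, val_of_ne_zero (mul_ne_zero hx hy), ← Units.val_mul,
    ← map_mul, Units.mk0_mul]

end SimplifiedFuzzyRing

namespace Tract

theorem mapDomain_incl {F : Type u} [CommGroupWithZero F] (φ : F →*₀ F) (x : F) :
    MonoidAlgebra.mapDomain (Units.map (φ : F →* F)) (incl x) = incl (φ x) := by
  by_cases hx : x = 0
  · simp [hx, incl]
  · have hφ : φ x ≠ 0 := (map_ne_zero φ).2 hx
    simp only [incl, hx, hφ, dite_false, MonoidAlgebra.of_apply, MonoidAlgebra.mapDomain_single]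
    congr 1
    ext; simp

/-- As `τ² = 1`, applying `τ` to the inner product swaps its arguments. -/
theorem Orthogonal.symm {F : Type u} [CommGroupWithZero F] {T : Tract F} {τ : T.Involution}
    {E : Type v} [Fintype E] {X Y : E → F} (h : Orthogonal τ X Y) : Orthogonal τ Y X := by
  have := τ.map_null _ h
  rw [inner, ← MonoidAlgebra.mapDomainRingHom_apply, map_sum] at this
  rw [Orthogonal, inner]
  convert this using 2 with e
  rw [MonoidAlgebra.mapDomainRingHom_apply, mapDomain_incl, map_mul, τ.involutive, mul_comm]

end Tract

/-- For `e ∉ A` there is a cocircuit through `e` avoiding `A`, or a circuit through `e` in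
`insert e A`. -/
theorem Matroid.exists_isCocircuit_disjoint_or_isCircuit_subset_insert {α : Type*} (M : Matroid α)
    {A : Set α} {e : α} (he : e ∈ M.E) (heA : e ∉ A) :
    (∃ Q, M.IsCocircuit Q ∧ Disjoint Q A ∧ e ∈ Q) ∨ ∃ C ⊆ insert e A, M.IsCircuit C ∧ e ∈ C := by
  by_cases h : e ∈ M.closure A
  · exact Or.inr (Matroid.exists_isCircuit_of_mem_closure h heA)
  · left
    have : (M.contract A).IsNonloop e := by
      rw [← Matroid.not_isLoop_iff (show e ∈ (M.contract A).E from ⟨he, heA⟩), Matroid.contract_isLoop_iff_mem_closure]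
      exact fun h' => h h'.1
    obtain ⟨Q, hQ, heQ⟩ := this.exists_mem_isCocircuit
    rw [Matroid.contract_isCocircuit_iff] at hQ
    exact ⟨Q, hQ.1, hQ.2, heQ⟩

open SimplifiedFuzzyRing in
theorem SimplifiedFuzzyRing.orthogonal_iff {K : Type u} [CommSemiring K]
    {R : SimplifiedFuzzyRing K} (τ : R.toTract.Involution) {E : Type v} [Fintype E]
    (X Y : E → WithZero Kˣ) :
    Tract.Orthogonal τ X Y ↔ ∑ e, val (X e) * val (τ.toHom (Y e)) ∈ R.K₀ := by
  simp only [← val_mul]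
  simp only [val, ← map_sum]
  rfl

open SimplifiedFuzzyRing in
theorem mainTheorem8 {K : Type u} [CommSemiring K] (R : SimplifiedFuzzyRing K)
    (hR : R.FR6'') : Tract.IsPerfect.{u, v} R.toTract := by
  classical
  intro τ E _ M X hX Y hY
  have hval : ∀ x : WithZero Kˣ, val x = 0 ∨ IsUnit (val x) := fun x => by
    by_cases hx : x = 0
    · exact Or.inl (by rw [hx, val_zero])
    · exact Or.inr (isUnit_val hx)
  have : Nontrivial K := ⟨1, 0, fun h => R.one_notMem (h ▸ R.K₀.zero_mem)⟩
  have hne : ∀ {x : WithZero Kˣ}, x ≠ 0 → val x ≠ 0 := fun hx => (isUnit_val hx).ne_zero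
  rw [orthogonal_iff]
  -- Twisting cocircuits and `Y` by `τ` turns orthogonality into a plain bilinear condition over
  -- `K`.
  refine hR.sum_mul_mem (C := (fun c e => val (c e)) '' M.circuits)
    (D := (fun d e => val (τ.toHom (d e))) '' M.cocircuits) ?_ ?_ ?_ ?_
    (fun e => val (X e)) Finset.univ ∅ (by simp) (fun e => val (τ.toHom (Y e))) ?_ ?_
  · rintro _ ⟨c, -, rfl⟩ e
    exact hval _
  · rintro _ ⟨d, -, rfl⟩ e
    exact hval _
  · rintro _ ⟨c, hc, rfl⟩ _ ⟨d, hd, rfl⟩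
    exact (orthogonal_iff τ c d).1 (M.orthogonal c hc d hd)
  · intro A e heA
    obtain ⟨Q, hQ, hQA, heQ⟩ | ⟨Q, hQA, hQ, heQ⟩ :=
      M.underlying.exists_isCocircuit_disjoint_or_isCircuit_subset_insert (A := (A : Set E))
        (e := e) (by simp [M.ground_eq]) (by simpa using heA)
    · obtain ⟨d, hd, rfl⟩ := M.isSignature_cocircuits.exists_support_eq Q hQ
      refine Or.inl ⟨_, ⟨d, hd, rfl⟩, fun a ha => ?_, ?_⟩
      · have : d a = 0 := by
          by_contra h
          exact Set.disjoint_left.1 hQA h ha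
        simp only [this, map_zero, val_zero]
      · exact hne ((map_ne_zero τ.toHom).2 heQ)
    · obtain ⟨c, hc, rfl⟩ := M.isSignature_circuits.exists_support_eq Q hQ
      refine Or.inr ⟨_, ⟨c, hc, rfl⟩, hne heQ, fun f hfA hfe => ?_⟩
      have : c f = 0 := by
        by_contra h
        obtain h' | h' := hQA h
        · exact hfe h'
        · exact hfA (by simpa using h')
      simp only [this, val_zero]
  · rintro _ ⟨d, hd, rfl⟩ -
    exact (orthogonal_iff τ X d).1 (hX d hd)
  · rintro _ ⟨c, hc, rfl⟩
    simp only [Finset.compl_empty, mul_comm (val (τ.toHom _))]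
    exact (orthogonal_iff τ c Y).1 (hY c hc).symm
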